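/- Let $\mathbb{S}^m$ be the space of real symmetric $m\times m$ matrices with inner product $\langle Y,Z\rangle=\operatorname{tr}(YZ)$ and Frobenius norm $\|\cdot\|_F$, let $\mathbb{S}^m_+$ be the cone of positive semidefinite matrices, $P$ the projection onto $\mathbb{S}^m_+$, and $\mathcal{L}_Y(Z)=Y\circ Z=(YZ+ZY)/2$ the Jordan product. Let $f:\mathbb{R}^n\to\mathbb{R}$ and $G:\mathbb{R}^n\to\mathbb{S}^m$ be twice continuously differentiable and consider the nonlinear semidefinite program $$\text{(NSDP)}\qquad \min_x\ f(x)\quad\text{subject to}\quad G(x)\in\mathbb{S}^m_+ .$$ A pair $(x,\Lambda)\in\mathbb{R}^n\times\mathbb{S}^m$ is a KKT pair of (NSDP) if $\nabla_x L(x,\Lambda)=0$, $\Lambda\circ G(x)=0$, $G(x)\in\mathbb{S}^m_+$ and $\Lambda\in\mathbb{S}^m_+$, where $L(x,\Lambda)=f(x)-\langle G(x),\Lambda\rangle$. Assume that every feasible $x$ is nondegenerate, that is, $$\mathbb{S}^m=\operatorname{lin}\mathcal{T}_{\mathbb{S}^m_+}(G(x))+\operatorname{Im}\nabla G(x),$$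 where $\mathcal{T}_{\mathbb{S}^m_+}(G(x))$ is the tangent cone of $\mathbb{S}^m_+$ at $G(x)$ and $\operatorname{lin}$ denotes the lineality space. Fix $\zeta_1,\zeta_2>0$ and put $r(x)=\tfrac12\|P(-G(x))\|_F^2$, $$N(x)=\nabla G(x)\nabla G(x)^*+\zeta_1^2\mathcal{L}_{G(x)}^2+\zeta_2^2\,r(x)\,I,\qquad \Lambda(x)=N(x)^{-1}\nabla G(x)\nabla f(x),$$ where $\nabla G(x):\mathbb{R}^n\to\mathbb{S}^m$ is the derivative of $G$ at $x$ and $\nabla G(x)^*$ its adjoint. For $c>0$ let $$L_c(x,\Lambda)=f(x)+\frac1{2c}\Big(\|P(\Lambda-c\,G(x))\|_F^2-\|\Lambda\|_F^2\Big)+\|N(x)(\Lambda(x)-\Lambda)\|_F^2 .$$ **Proposition.** Let $\hat x\in\mathbb{R}^n$ be feasible for (NSDP) and let $\hat\Lambda\in\mathbb{S}^m$ be arbitrary. Then there exist $\hat c,\hat\delta_1,\hat\delta_2>0$ such that the following holds: if $c\ge\hat c$ and $(x,\Lambda)\in\mathbb{R}^n\times\mathbb{S}^m$ is stationary for $L_c$,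 that is, $\nabla_xL_c(x,\Lambda)=0$ and $\nabla_\Lambda L_c(x,\Lambda)=0$, with $\|x-\hat x\|\le\hat\delta_1$ and $\|\Lambda-\hat\Lambda\|_F\le\hat\delta_2$, then $(x,\Lambda)$ is a KKT pair of (NSDP). -/

import Mathlib

namespace NSDP

/-- The real symmetric `m × m` matrices, as a subspace of all matrices. -/
def symSubmodule (m : ℕ) : Submodule ℝ (Matrix (Fin m) (Fin m) ℝ) where
  carrier := {A | A.IsSymm}
  add_mem' ha hb := Matrix.IsSymm.add ha hb
  zero_mem' := Matrix.isSymm_zero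
  smul_mem' c _ ha := Matrix.IsSymm.smul ha c

/-- The linear space `𝕊ᵐ` of real symmetric `m × m` matrices. It is a type of its own, so that the
only norm and topology on it are those of the inner product `⟪Y, Z⟫ = tr (Y Z)` below. -/
def SymMat (m : ℕ) : Type := symSubmodule m

namespace SymMat

variable {m : ℕ}

instance : AddCommGroup (SymMat m) := inferInstanceAs (AddCommGroup (symSubmodule m))

instance : Module ℝ (SymMat m) := inferInstanceAs (Module ℝ (symSubmodule m))

instance : FiniteDimensional ℝ (SymMat m) :=
  inferInstanceAs (FiniteDimensional ℝ (symSubmodule m))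

/-- The underlying matrix. -/
def mat : SymMat m →ₗ[ℝ] Matrix (Fin m) (Fin m) ℝ := (symSubmodule m).subtype

/-- A symmetric matrix as an element of `𝕊ᵐ`. -/
def ofMat (A : Matrix (Fin m) (Fin m) ℝ) (hA : A.IsSymm) : SymMat m := ⟨A, hA⟩

@[simp] theorem mat_ofMat (A : Matrix (Fin m) (Fin m) ℝ) (hA : A.IsSymm) :
    mat (ofMat A hA) = A := rfl

theorem isSymm (A : SymMat m) : (mat A).IsSymm := A.2

theorem mat_injective : Function.Injective (mat : SymMat m → Matrix (Fin m) (Fin m) ℝ) :=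
  Subtype.val_injective

theorem mat_apply_comm (Y : SymMat m) (i j : Fin m) : mat Y j i = mat Y i j :=
  (isSymm Y).apply i j

theorem trace_mul_self (Y : SymMat m) :
    (mat Y * mat Y).trace = ∑ i : Fin m, ∑ j : Fin m, mat Y i j ^ 2 := by
  simp only [Matrix.trace, Matrix.diag, Matrix.mul_apply]
  refine Finset.sum_congr rfl fun i _ => Finset.sum_congr rfl fun j _ => ?_
  rw [mat_apply_comm Y i j, sq]

theorem trace_mul_self_nonneg (Y : SymMat m) : 0 ≤ (mat Y * mat Y).trace := by
  rw [trace_mul_self]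
  exact Finset.sum_nonneg fun i _ => Finset.sum_nonneg fun j _ => sq_nonneg _

theorem eq_zero_of_trace_mul_self (Y : SymMat m) (hY : (mat Y * mat Y).trace = 0) : Y = 0 := by
  rw [trace_mul_self] at hY
  apply mat_injective
  rw [map_zero]
  ext i j
  have h1 := (Finset.sum_eq_zero_iff_of_nonneg
    (fun i _ => Finset.sum_nonneg fun j _ => sq_nonneg (mat Y i j))).1 hY i (Finset.mem_univ i)
  have h2 := (Finset.sum_eq_zero_iff_of_nonneg
    (fun j _ => sq_nonneg (mat Y i j))).1 h1 j (Finset.mem_univ j)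
  exact pow_eq_zero_iff (two_ne_zero) |>.1 h2

/-- The inner product `⟪Y, Z⟫ = tr (Y Z)` on `𝕊ᵐ`. -/
noncomputable abbrev innerCore (m : ℕ) : InnerProductSpace.Core ℝ (SymMat m) where
  inner Y Z := (mat Y * mat Z).trace
  conj_inner_symm Y Z := Matrix.trace_mul_comm (mat Z) (mat Y)
  re_inner_nonneg Y := trace_mul_self_nonneg Y
  add_left X Y Z := by rw [map_add, add_mul, Matrix.trace_add]
  smul_left X Y c := by rw [map_smul, Matrix.smul_mul, Matrix.trace_smul]; rfl
  definite Y hY := eq_zero_of_trace_mul_self Y hY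

noncomputable instance : NormedAddCommGroup (SymMat m) :=
  (innerCore m).toNormedAddCommGroup

noncomputable instance : InnerProductSpace ℝ (SymMat m) :=
  InnerProductSpace.ofCore (innerCore m).toCore

instance : CompleteSpace (SymMat m) := FiniteDimensional.complete ℝ (SymMat m)

theorem inner_eq_trace (Y Z : SymMat m) : inner ℝ Y Z = (mat Y * mat Z).trace := rfl

/-- The Jordan product `Y ∘ Z = (Y Z + Z Y) / 2`. -/
noncomputable def jordan (Y Z : SymMat m) : SymMat m :=
  ofMat ((1 / 2 : ℝ) • (mat Y * mat Z + mat Z * mat Y)) (by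
    have hY : (mat Y).transpose = mat Y := isSymm Y
    have hZ : (mat Z).transpose = mat Z := isSymm Z
    simp [Matrix.IsSymm, Matrix.transpose_mul, hY, hZ, add_comm])

theorem mat_jordan (Y Z : SymMat m) :
    mat (jordan Y Z) = (1 / 2 : ℝ) • (mat Y * mat Z + mat Z * mat Y) := rfl

/-- The linear operator `𝓛_Y : Z ↦ Y ∘ Z` on `𝕊ᵐ`. -/
noncomputable def jordanL (Y : SymMat m) : SymMat m →L[ℝ] SymMat m :=
  LinearMap.toContinuousLinearMap
    { toFun := jordan Y
      map_add' := fun A B => mat_injective (by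
        rw [map_add, mat_jordan, mat_jordan, mat_jordan, map_add, ← smul_add, mul_add, add_mul]
        congr 1
        abel)
      map_smul' := fun c A => mat_injective (by
        rw [RingHom.id_apply, map_smul, mat_jordan, mat_jordan, map_smul, Matrix.mul_smul,
          Matrix.smul_mul, ← smul_add, smul_comm]) }

theorem jordanL_apply (Y Z : SymMat m) : jordanL Y Z = jordan Y Z := rfl

/-- The cone `𝕊ᵐ₊` of positive semidefinite matrices in `𝕊ᵐ`. -/
def psdCone (m : ℕ) : Set (SymMat m) := {A | (mat A).PosSemidef}

theorem zero_mem_psdCone : (0 : SymMat m) ∈ psdCone m := by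
  simp [psdCone, Matrix.PosSemidef.zero]

theorem convex_psdCone : Convex ℝ (psdCone m) := by
  intro A hA B hB a b ha hb _
  have hA' : (mat A).PosSemidef := hA
  have hB' : (mat B).PosSemidef := hB
  simpa [psdCone] using (hA'.smul ha).add (hB'.smul hb)

theorem isClosed_psdCone : IsClosed (psdCone m) := by
  have h : psdCone m = ⋂ v : Fin m → ℝ, {A | 0 ≤ dotProduct v ((mat A).mulVec v)} := by
    ext A
    simp only [psdCone, Set.mem_ofPred_eq, Set.mem_iInter, Matrix.posSemidef_iff_dotProduct_mulVec]
    constructor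
    · intro hA v
      simpa using hA.2 v
    · intro hA
      refine ⟨?_, fun v => by simpa using hA v⟩
      exact (Matrix.conjTranspose_eq_transpose_of_trivial (mat A)).trans (isSymm A)
  rw [h]
  have hc : Continuous (mat : SymMat m → Matrix (Fin m) (Fin m) ℝ) :=
    LinearMap.continuous_of_finiteDimensional mat
  refine isClosed_iInter fun v => isClosed_le continuous_const ?_
  exact continuous_const.dotProduct (hc.matrix_mulVec continuous_const)

/-- Every symmetric matrix has exactly one nearest point in `𝕊ᵐ₊`. -/
theorem existsUnique_nearest (Z : SymMat m) :
    ∃! P : SymMat m, P ∈ psdCone m ∧ ∀ W ∈ psdCone m, ‖Z - P‖ ≤ ‖Z - W‖ := by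
  have key : ∀ P : SymMat m, P ∈ psdCone m → (∀ W ∈ psdCone m, ‖Z - P‖ ≤ ‖Z - W‖) →
      ∀ W ∈ psdCone m, inner ℝ (Z - P) (W - P) ≤ 0 := by
    intro P hP hmin
    rw [← norm_eq_iInf_iff_real_inner_le_zero convex_psdCone hP]
    have : Nonempty (psdCone m) := ⟨⟨P, hP⟩⟩
    refine le_antisymm (le_ciInf fun W => hmin W W.2) ?_
    exact ciInf_le (f := fun W : psdCone m => ‖Z - W‖)
      ⟨0, Set.forall_mem_range.2 fun _ => norm_nonneg _⟩ ⟨P, hP⟩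
  obtain ⟨P, hP, hPmin⟩ := exists_norm_eq_iInf_of_complete_convex
    ⟨0, zero_mem_psdCone (m := m)⟩ isClosed_psdCone.isComplete convex_psdCone Z
  have hPle : ∀ W ∈ psdCone m, ‖Z - P‖ ≤ ‖Z - W‖ := fun W hW => by
    rw [hPmin]
    exact ciInf_le (f := fun W : psdCone m => ‖Z - W‖)
      ⟨0, Set.forall_mem_range.2 fun _ => norm_nonneg _⟩ ⟨W, hW⟩
  refine ⟨P, ⟨hP, hPle⟩, ?_⟩
  rintro Q ⟨hQ, hQle⟩
  have h1 := key P hP hPle Q hQ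
  have h2 := key Q hQ hQle P hP
  have h3 : inner ℝ (Q - P) (Q - P) = inner ℝ (Z - P) (Q - P) + inner ℝ (Z - Q) (P - Q) := by
    rw [← neg_sub Q P, inner_neg_right, ← sub_eq_add_neg, ← inner_sub_left]
    congr 1
    abel
  have h4 : inner ℝ (Q - P) (Q - P) = 0 := le_antisymm (by linarith) real_inner_self_nonneg
  exact sub_eq_zero.1 (inner_self_eq_zero.1 h4)

/-- The projection onto `𝕊ᵐ₊`: the nearest point of `𝕊ᵐ₊` in the Frobenius norm. -/
noncomputable def proj (Z : SymMat m) : SymMat m := (existsUnique_nearest Z).choose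

theorem proj_mem (Z : SymMat m) : proj Z ∈ psdCone m := (existsUnique_nearest Z).choose_spec.1.1

theorem norm_sub_proj_le (Z : SymMat m) {W : SymMat m} (hW : W ∈ psdCone m) :
    ‖Z - proj Z‖ ≤ ‖Z - W‖ := (existsUnique_nearest Z).choose_spec.1.2 W hW

end SymMat

open SymMat

/-- The lineality space of a closed convex cone `T`, that is, `T ∩ (-T)`. -/
def lin {E : Type*} [AddCommGroup E] (T : Set E) : Set E := {v | v ∈ T ∧ -v ∈ T}

section Problem

variable {n m : ℕ} (f : EuclideanSpace ℝ (Fin n) → ℝ) (G : EuclideanSpace ℝ (Fin n) → SymMat m)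

/-- Feasibility for the problem: minimize `f x` subject to `G x ∈ 𝕊ᵐ₊`. -/
def Feasible (x : EuclideanSpace ℝ (Fin n)) : Prop := G x ∈ psdCone m

/-- The Lagrangian `L(x, Λ) = f(x) - ⟪G(x), Λ⟫`. -/
noncomputable def lagrangian (x : EuclideanSpace ℝ (Fin n)) (Λ : SymMat m) : ℝ :=
  f x - inner ℝ (G x) Λ

/-- `(x, Λ)` is a KKT pair of the problem: minimize `f x` subject to `G x ∈ 𝕊ᵐ₊`. -/
structure IsKKTPair (x : EuclideanSpace ℝ (Fin n)) (Λ : SymMat m) : Prop where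
  grad_eq_zero : gradient (fun y => lagrangian f G y Λ) x = 0
  complementarity : jordan Λ (G x) = 0
  feasible : G x ∈ psdCone m
  multiplier_mem : Λ ∈ psdCone m

/-- The point `x` is nondegenerate: `𝕊ᵐ = lin 𝒯(G(x)) + Im ∇G(x)`, where `𝒯(G(x))` is the tangent
cone of `𝕊ᵐ₊` at `G(x)`. -/
def Nondegenerate (x : EuclideanSpace ℝ (Fin n)) : Prop :=
  ∀ Z : SymMat m, ∃ H ∈ lin (posTangentConeAt (psdCone m) (G x)),
    ∃ v : EuclideanSpace ℝ (Fin n), Z = H + fderiv ℝ G x v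

/-- The residual `r(x) = ‖P(-G(x))‖² / 2`. -/
noncomputable def residual (x : EuclideanSpace ℝ (Fin n)) : ℝ := (1 / 2) * ‖proj (-G x)‖ ^ 2

/-- The operator `N(x) = ∇G(x) ∇G(x)* + ζ₁² 𝓛_{G(x)}² + ζ₂² r(x) I` on `𝕊ᵐ`. -/
noncomputable def opN (ζ₁ ζ₂ : ℝ) (x : EuclideanSpace ℝ (Fin n)) : SymMat m →L[ℝ] SymMat m :=
  (fderiv ℝ G x).comp (ContinuousLinearMap.adjoint (fderiv ℝ G x))
    + ζ₁ ^ 2 • (jordanL (G x)).comp (jordanL (G x))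
    + (ζ₂ ^ 2 * residual G x) • ContinuousLinearMap.id ℝ (SymMat m)

/-- The multiplier estimate `Λ(x) = N(x)⁻¹ ∇G(x) ∇f(x)`. -/
noncomputable def multiplierEstimate (ζ₁ ζ₂ : ℝ) (x : EuclideanSpace ℝ (Fin n)) : SymMat m :=
  (opN G ζ₁ ζ₂ x).inverse (fderiv ℝ G x (gradient f x))

/-- The augmented Lagrangian
`L_c(x, Λ) = f(x) + (‖P(Λ - c G(x))‖² - ‖Λ‖²) / (2c) + ‖N(x)(Λ(x) - Λ)‖²`. -/
noncomputable def augLagrangian (ζ₁ ζ₂ c : ℝ) (x : EuclideanSpace ℝ (Fin n)) (Λ : SymMat m) : ℝ :=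
  f x + 1 / (2 * c) * (‖proj (Λ - c • G x)‖ ^ 2 - ‖Λ‖ ^ 2)
    + ‖opN G ζ₁ ζ₂ x (multiplierEstimate f G ζ₁ ζ₂ x - Λ)‖ ^ 2

/-- `(x, Λ)` is stationary for `L_c`: both partial gradients of `L_c` vanish at `(x, Λ)`. -/
def IsStationary (ζ₁ ζ₂ c : ℝ) (x : EuclideanSpace ℝ (Fin n)) (Λ : SymMat m) : Prop :=
  gradient (fun y => augLagrangian f G ζ₁ ζ₂ c y Λ) x = 0 ∧
    gradient (fun M => augLagrangian f G ζ₁ ζ₂ c x M) Λ = 0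

end Problem

end NSDP

namespace NSDP

/-! Put `w = ∇G(x)∇f(x) - N(x)Λ`, which is `N(x)(Λ(x) - Λ)` where `N(x)` is invertible, and `Y = P(Λ
- cG(x))`. Stationarity reads `Y = Λ + 2cNw` and `∇f = ∇G* Y - 2(Dw)* w`. If `w = 0`, then `Y = Λ`,
and Moreau's decomposition of `Λ - cG(x)` yields all the KKT conditions; so everything rests on
showing `w = 0`.

Moreau says that `Y` and `c(2Nw + G(x))` are positive semidefinite and complementary. Hence `𝓛_G Y =
-2 𝓛_Y Nw`, and `‖P(-G(x))‖ ≤ 2‖Nw‖`. Applying `N` to the first equation and inserting the second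
gives `2cN²w = w - 2ζ₁² 𝓛_G 𝓛_Y Nw + ζ₂² r Y + 2∇G (Dw)* w`, whose right side is `O((1 + ‖Y‖)‖w‖)`.
Nondegeneracy makes `N` injective at the feasible point, hence uniformly bounded below nearby, so
the left side is at least `2cμ²‖w‖`. As `P` is nonexpansive and kills `-cG(x₀)`, `‖Y‖ ≤ R + cε` with
`ε` small near `x₀`. For large `c` the left side wins unless `w = 0`. -/

theorem _root_.IsLinearMap.isBoundedLinearMap_of_finiteDimensional {E F : Type*}
    [NormedAddCommGroup E] [NormedSpace ℝ E] [FiniteDimensional ℝ E] [NormedAddCommGroup F]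
    [NormedSpace ℝ F] {g : E → F} (h : IsLinearMap ℝ g) : IsBoundedLinearMap ℝ g :=
  (LinearMap.toContinuousLinearMap (IsLinearMap.mk' g h)).isBoundedLinearMap

namespace SymMat

/-! ### Self-duality and complementarity in the semidefinite cone -/

open scoped MatrixOrder Matrix.Norms.L2Operator in
theorem exists_mat_eq_conjTranspose_mul_self {m : ℕ} {A : Matrix (Fin m) (Fin m) ℝ}
    (hA : A.PosSemidef) : ∃ B : Matrix (Fin m) (Fin m) ℝ, A = B.conjTranspose * B := by
  obtain ⟨B, rfl⟩ := CStarAlgebra.nonneg_iff_eq_star_mul_self.mp hA.nonneg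
  exact ⟨B, rfl⟩

variable {m : ℕ}

theorem inner_nonneg_of_mem_psdCone {Y Z : SymMat m} (hY : Y ∈ psdCone m) (hZ : Z ∈ psdCone m) :
    0 ≤ inner ℝ Y Z := by
  obtain ⟨B, hB⟩ := exists_mat_eq_conjTranspose_mul_self (show (mat Y).PosSemidef from hY)
  rw [inner_eq_trace, hB, Matrix.mul_assoc, Matrix.trace_mul_comm]
  exact (Matrix.PosSemidef.mul_mul_conjTranspose_same hZ B).trace_nonneg

/-- Factoring `Y = BᵀB` and `Z = CᵀC` turns `tr(YZ)` into `‖BCᵀ‖²`, so `BCᵀ = 0`. -/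
theorem mat_mul_eq_zero_of_inner_eq_zero {Y Z : SymMat m} (hY : Y ∈ psdCone m)
    (hZ : Z ∈ psdCone m) (h : inner ℝ Y Z = 0) : mat Y * mat Z = 0 := by
  obtain ⟨B, hB⟩ := exists_mat_eq_conjTranspose_mul_self (show (mat Y).PosSemidef from hY)
  obtain ⟨C, hC⟩ := exists_mat_eq_conjTranspose_mul_self (show (mat Z).PosSemidef from hZ)
  rw [inner_eq_trace, hB, hC] at h
  have h1 : ((B * C.conjTranspose) * (B * C.conjTranspose).conjTranspose).trace = 0 := by
    rw [← h, Matrix.conjTranspose_mul, Matrix.conjTranspose_conjTranspose, Matrix.mul_assoc B.conjTranspose,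
      Matrix.trace_mul_comm B.conjTranspose]
    simp only [Matrix.mul_assoc]
  rw [Matrix.trace_mul_conjTranspose_self_eq_zero_iff] at h1
  rw [hB, hC, Matrix.mul_assoc, ← Matrix.mul_assoc B, h1]
  simp

/-- The rank-one matrix `v vᵀ`. -/
def rankOne (v : Fin m → ℝ) : SymMat m :=
  ofMat (Matrix.vecMulVec v v) (show (Matrix.vecMulVec v v).IsSymm from Matrix.transpose_vecMulVec v v)

theorem mat_rankOne (v : Fin m → ℝ) : mat (rankOne v) = Matrix.vecMulVec v v := rfl

theorem rankOne_mem_psdCone (v : Fin m → ℝ) : rankOne v ∈ psdCone m := by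
  have := Matrix.posSemidef_vecMulVec_self_star v
  rwa [star_trivial] at this

theorem inner_rankOne (Z : SymMat m) (v : Fin m → ℝ) :
    inner ℝ Z (rankOne v) = dotProduct v ((mat Z).mulVec v) := by
  rw [inner_eq_trace, mat_rankOne, Matrix.mul_vecMulVec, Matrix.trace_vecMulVec,
    dotProduct_comm]

/-- The cone of positive semidefinite matrices is self-dual. -/
theorem mem_psdCone_of_forall_inner_nonneg {Z : SymMat m}
    (h : ∀ W ∈ psdCone m, 0 ≤ inner ℝ Z W) : Z ∈ psdCone m := by
  refine Matrix.posSemidef_iff_dotProduct_mulVec.2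
    ⟨(Matrix.conjTranspose_eq_transpose_of_trivial (mat Z)).trans (isSymm Z), fun v => ?_⟩
  simpa [inner_rankOne] using h _ (rankOne_mem_psdCone v)

theorem smul_mem_psdCone {Z : SymMat m} (hZ : Z ∈ psdCone m) {a : ℝ} (ha : 0 ≤ a) :
    a • Z ∈ psdCone m := by
  have := Matrix.PosSemidef.smul (show (mat Z).PosSemidef from hZ) ha
  simpa [psdCone] using this

theorem add_mem_psdCone {Y Z : SymMat m} (hY : Y ∈ psdCone m) (hZ : Z ∈ psdCone m) :
    Y + Z ∈ psdCone m := by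
  have := Matrix.PosSemidef.add (show (mat Y).PosSemidef from hY) hZ
  simpa [psdCone] using this

/-! ### The projection, Moreau's decomposition and the squared distance -/

/-- The variational inequality characterizing the projection. -/
theorem inner_sub_proj_le (Z : SymMat m) {W : SymMat m} (hW : W ∈ psdCone m) :
    inner ℝ (Z - proj Z) (W - proj Z) ≤ 0 := by
  refine (norm_eq_iInf_iff_real_inner_le_zero convex_psdCone (proj_mem Z)).1 ?_ W hW
  have : Nonempty (psdCone m) := ⟨⟨_, proj_mem Z⟩⟩
  refine le_antisymm (le_ciInf fun W => norm_sub_proj_le Z W.2) ?_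
  exact ciInf_le (f := fun W : psdCone m => ‖Z - W‖)
    ⟨0, Set.forall_mem_range.2 fun _ => norm_nonneg _⟩ ⟨_, proj_mem Z⟩

theorem inner_proj_self (Z : SymMat m) : inner ℝ Z (proj Z) = ‖proj Z‖ ^ 2 := by
  -- The cone points `0` and `2P(Z)` give the two opposite inequalities.
  have h1 := inner_sub_proj_le Z zero_mem_psdCone
  have h2 := inner_sub_proj_le Z (add_mem_psdCone (proj_mem Z) (proj_mem Z))
  rw [zero_sub, inner_neg_right, inner_sub_left, real_inner_self_eq_norm_sq] at h1
  rw [add_sub_cancel_right, inner_sub_left, real_inner_self_eq_norm_sq] at h2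
  linarith

/-- Moreau's decomposition: `P(Z) - Z` is the projection of `-Z`, hence positive semidefinite. -/
theorem proj_sub_self_mem_psdCone (Z : SymMat m) : proj Z - Z ∈ psdCone m := by
  refine mem_psdCone_of_forall_inner_nonneg fun W hW => ?_
  have h := inner_sub_proj_le Z (add_mem_psdCone hW (proj_mem Z))
  rw [add_sub_cancel_right, ← neg_sub, inner_neg_left] at h
  linarith

theorem inner_proj_proj_sub_self (Z : SymMat m) : inner ℝ (proj Z) (proj Z - Z) = 0 := by
  rw [inner_sub_right, real_inner_comm Z, inner_proj_self, real_inner_self_eq_norm_sq,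
    sub_self]

theorem jordan_comm (Y Z : SymMat m) : jordan Y Z = jordan Z Y :=
  mat_injective (by rw [mat_jordan, mat_jordan, add_comm])

theorem jordan_eq_zero_of_inner_eq_zero {Y Z : SymMat m} (hY : Y ∈ psdCone m)
    (hZ : Z ∈ psdCone m) (h : inner ℝ Y Z = 0) : jordan Y Z = 0 := by
  apply mat_injective
  rw [mat_jordan, mat_mul_eq_zero_of_inner_eq_zero hY hZ h,
    mat_mul_eq_zero_of_inner_eq_zero hZ hY (by rw [real_inner_comm, h])]
  simp

theorem jordan_proj_proj_sub_self (Z : SymMat m) : jordan (proj Z) (proj Z - Z) = 0 :=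
  jordan_eq_zero_of_inner_eq_zero (proj_mem Z) (proj_sub_self_mem_psdCone Z)
    (inner_proj_proj_sub_self Z)

/-- Adding the variational inequalities at `Y` and `Z`, each tested with the other projection,
bounds `‖P(Y) - P(Z)‖²` by `⟪Y - Z, P(Y) - P(Z)⟫`; Cauchy–Schwarz finishes. -/
theorem norm_proj_sub_proj_le (Y Z : SymMat m) : ‖proj Y - proj Z‖ ≤ ‖Y - Z‖ := by
  have h1 := inner_sub_proj_le Y (proj_mem Z)
  have h2 := inner_sub_proj_le Z (proj_mem Y)
  have h3 : inner ℝ (Y - proj Y) (proj Z - proj Y) + inner ℝ (Z - proj Z) (proj Y - proj Z)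
      = ‖proj Y - proj Z‖ ^ 2 - inner ℝ (Y - Z) (proj Y - proj Z) := by
    rw [← real_inner_self_eq_norm_sq, ← neg_sub (proj Y) (proj Z), inner_neg_right,
      ← sub_eq_neg_add, ← inner_sub_left, ← inner_sub_left]
    congr 1
    abel
  have h4 := real_inner_le_norm (Y - Z) (proj Y - proj Z)
  rcases (norm_nonneg (proj Y - proj Z)).eq_or_lt with h | h
  · rw [← h]
    exact norm_nonneg _
  · refine le_of_mul_le_mul_right ?_ h
    nlinarith

theorem continuous_proj : Continuous (proj : SymMat m → SymMat m) :=
  (LipschitzWith.of_dist_le_mul (K := 1) fun Y Z => by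
    simpa [dist_eq_norm] using norm_proj_sub_proj_le Y Z).continuous

theorem proj_neg_eq_zero {Z : SymMat m} (hZ : Z ∈ psdCone m) : proj (-Z) = 0 := by
  have h1 := inner_proj_self (-Z)
  have h2 := inner_nonneg_of_mem_psdCone hZ (proj_mem (-Z))
  rw [inner_neg_left] at h1
  have h3 := sq_nonneg ‖proj (-Z)‖
  have h4 : ‖proj (-Z)‖ ^ 2 = 0 := by linarith
  simpa using h4

theorem norm_proj_neg_le (Y : SymMat m) {Z : SymMat m} (hZ : Z ∈ psdCone m) :
    ‖proj (-Y)‖ ≤ ‖Z - Y‖ := by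
  have h := norm_proj_sub_proj_le (-Y) (-Z)
  rw [proj_neg_eq_zero hZ, sub_zero] at h
  rwa [show -Y - -Z = Z - Y by abel] at h

/-- A subgradient inequality: expand `‖W - P(W)‖² ≤ ‖W - P(Z)‖²` using `⟪W, P(W)⟫ = ‖P(W)‖²`. -/
theorem norm_sq_proj_add_inner_le (Z W : SymMat m) :
    ‖proj Z‖ ^ 2 + 2 * inner ℝ (proj Z) (W - Z) ≤ ‖proj W‖ ^ 2 := by
  have h1 : ‖W - proj W‖ ^ 2 ≤ ‖W - proj Z‖ ^ 2 :=
    pow_le_pow_left₀ (norm_nonneg _) (norm_sub_proj_le W (proj_mem Z)) 2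
  rw [norm_sub_sq_real, norm_sub_sq_real, inner_proj_self] at h1
  rw [inner_sub_right, real_inner_comm, real_inner_comm Z, inner_proj_self]
  linarith

/-- The squared norm of the projection is differentiable, with gradient `2 P(Z)`. -/
theorem hasFDerivAt_norm_sq_proj (Z : SymMat m) :
    HasFDerivAt (fun Y : SymMat m => ‖proj Y‖ ^ 2) ((2 : ℝ) • innerSL ℝ (proj Z)) Z := by
  refine HasFDerivAt.of_isLittleO (Asymptotics.IsBigO.trans_isLittleO (g := fun W => ‖W - Z‖ ^ 2) ?_ ?_)
  -- The subgradient inequalities at `Z` and at `W` trap the remainder between `0` and `2⟪P(W) -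
  -- P(Z), W - Z⟫`, which is at most `2‖W - Z‖²`.
  · refine Asymptotics.IsBigO.of_bound 2 (Filter.Eventually.of_forall fun W => ?_)
    have h1 := norm_sq_proj_add_inner_le Z W
    have h2 := norm_sq_proj_add_inner_le W Z
    have h3 : inner ℝ (proj W - proj Z) (W - Z) ≤ ‖W - Z‖ * ‖W - Z‖ :=
      (real_inner_le_norm _ _).trans
        (mul_le_mul_of_nonneg_right (norm_proj_sub_proj_le W Z) (norm_nonneg _))
    rw [← neg_sub W Z, inner_neg_right] at h2
    rw [inner_sub_left] at h3
    simp only [smul_apply, innerSL_apply_apply, smul_eq_mul, norm_pow, norm_norm]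
    rw [Real.norm_eq_abs, abs_le]
    constructor <;> nlinarith [sq_nonneg ‖W - Z‖]
  · have h : Filter.Tendsto (fun W : SymMat m => W - Z) (nhds Z) (nhds 0) := by
      have : Filter.Tendsto (fun W : SymMat m => W - Z) (nhds Z) (nhds (Z - Z)) :=
        (continuous_id.sub continuous_const).tendsto Z
      rwa [sub_self] at this
    exact (Asymptotics.isLittleO_norm_pow_id (E' := SymMat m) one_lt_two).comp_tendsto h

theorem contDiff_norm_sq_proj : ContDiff ℝ 1 (fun Y : SymMat m => ‖proj Y‖ ^ 2) := by
  refine contDiff_one_iff_hasFDerivAt.2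
    ⟨fun Z => (2 : ℝ) • innerSL ℝ (proj Z), ?_, hasFDerivAt_norm_sq_proj⟩
  exact ((innerSL ℝ).continuous.comp continuous_proj).const_smul (2 : ℝ)

theorem isBoundedLinearMap_jordanL :
    IsBoundedLinearMap ℝ (jordanL : SymMat m → SymMat m →L[ℝ] SymMat m) := by
  have h : IsLinearMap ℝ (jordanL : SymMat m → SymMat m →L[ℝ] SymMat m) :=
    { map_add := fun A B => by
        ext Z : 1
        rw [add_apply, jordanL_apply, jordan_comm, ← jordanL_apply, map_add,
          jordanL_apply, jordanL_apply, jordanL_apply, jordanL_apply, jordan_comm Z,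
          jordan_comm Z]
      map_smul := fun c A => by
        ext Z : 1
        rw [smul_apply, jordanL_apply, jordan_comm, ← jordanL_apply, map_smul,
          jordanL_apply, jordanL_apply, jordan_comm Z] }
  exact IsLinearMap.isBoundedLinearMap_of_finiteDimensional (E := SymMat m)
    (F := SymMat m →L[ℝ] SymMat m) h

theorem inner_jordanL_left (Y A B : SymMat m) :
    inner ℝ (jordanL Y A) B = inner ℝ A (jordanL Y B) := by
  simp only [inner_eq_trace, jordanL_apply, mat_jordan, Matrix.smul_mul, Matrix.mul_smul,
    Matrix.trace_smul, add_mul, mul_add, Matrix.trace_add]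
  rw [Matrix.mul_assoc (mat Y), Matrix.trace_mul_comm (mat Y), Matrix.mul_assoc,
    Matrix.mul_assoc, add_comm]

end SymMat
end NSDP

namespace NSDP

open SymMat

/-! ### Complementary matrices are orthogonal to the lineality space -/

namespace SymMat

variable {m : ℕ}

/-- Multiplying `YZ + ZY = 0` by `Z` and taking traces gives `tr(ZYZ) = 0`. With `Y = BᵀB` this is
`‖BZ‖² = 0`, so `Z` need not be semidefinite. -/
theorem mat_mul_eq_zero_of_jordan_eq_zero {Y Z : SymMat m} (hY : Y ∈ psdCone m)
    (h : jordan Y Z = 0) : mat Y * mat Z = 0 := by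
  have hZ : (mat Z).conjTranspose = mat Z :=
    (Matrix.conjTranspose_eq_transpose_of_trivial (mat Z)).trans (isSymm Z)
  have h1 : mat Y * mat Z + mat Z * mat Y = 0 := by
    have h2 := congrArg mat h
    rw [mat_jordan, map_zero] at h2
    exact (smul_eq_zero_iff_right (by norm_num)).1 h2
  have h3 : (mat Z * mat Y * mat Z).trace = 0 := by
    have h4 := congrArg (fun A => (mat Z * A).trace) h1
    simp only [mul_add, Matrix.trace_add, mul_zero, Matrix.trace_zero] at h4
    rw [← Matrix.mul_assoc, Matrix.trace_mul_comm (mat Z) (mat Z * mat Y)] at h4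
    linarith
  obtain ⟨B, hB⟩ := exists_mat_eq_conjTranspose_mul_self (show (mat Y).PosSemidef from hY)
  rw [hB] at h3 ⊢
  have h5 : ((B * mat Z).conjTranspose * (B * mat Z)).trace = 0 := by
    rw [← h3, Matrix.conjTranspose_mul, hZ]
    simp only [Matrix.mul_assoc]
  rw [Matrix.trace_conjTranspose_mul_self_eq_zero_iff] at h5
  rw [Matrix.mul_assoc, h5, mul_zero]

/-- The functional `⟪V, ·⟫` is minimal over the cone at `Y`, so its derivative vanishes along
two-sided tangent directions. -/
theorem inner_lin_posTangentConeAt {Y V H : SymMat m} (hV : V ∈ psdCone m)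
    (hYV : inner ℝ Y V = 0) (hH : H ∈ lin (posTangentConeAt (psdCone m) Y)) :
    inner ℝ V H = 0 := by
  have hmin : IsLocalMinOn (innerSL ℝ V) (psdCone m) Y := by
    refine IsMinOn.localize fun W hW => ?_
    rw [Set.mem_ofPred_eq, innerSL_apply_apply, innerSL_apply_apply, real_inner_comm, hYV]
    exact inner_nonneg_of_mem_psdCone hV hW
  simpa using hmin.hasFDerivWithinAt_eq_zero (innerSL ℝ V).hasFDerivWithinAt hH.1 hH.2

/-- Split `W = P(W) - V` into semidefinite parts with `V P(W) = 0`. From `Y P(W) = Y V` follows `(Y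
P(W))(Y P(W))ᵀ = Y V P(W) Y = 0`, so `Y` annihilates both parts and the semidefinite case applies to
each. -/
theorem inner_lin_posTangentConeAt_of_mul_eq_zero {Y W H : SymMat m}
    (h : mat Y * mat W = 0) (hH : H ∈ lin (posTangentConeAt (psdCone m) Y)) :
    inner ℝ W H = 0 := by
  set V := proj W - W with hVdef
  have hV : V ∈ psdCone m := proj_sub_self_mem_psdCone W
  have hPV : mat (proj W) * mat V = 0 :=
    mat_mul_eq_zero_of_inner_eq_zero (proj_mem W) hV (inner_proj_proj_sub_self W)
  have hVP : mat V * mat (proj W) = 0 :=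
    mat_mul_eq_zero_of_inner_eq_zero hV (proj_mem W)
      (by rw [real_inner_comm, inner_proj_proj_sub_self])
  have hconj : ∀ Z : SymMat m, (mat Z).conjTranspose = mat Z := fun Z =>
    (Matrix.conjTranspose_eq_transpose_of_trivial (mat Z)).trans (isSymm Z)
  have heq : mat Y * mat (proj W) = mat Y * mat V := by
    rw [hVdef, map_sub, mul_sub, h, sub_zero]
  have hYP : mat Y * mat (proj W) = 0 := by
    rw [← Matrix.self_mul_conjTranspose_eq_zero, Matrix.conjTranspose_mul, hconj, hconj,
      ← Matrix.mul_assoc, heq, Matrix.mul_assoc (mat Y), hVP]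
    simp
  have hYV : mat Y * mat V = 0 := heq ▸ hYP
  have h1 := inner_lin_posTangentConeAt (proj_mem W)
    (by rw [inner_eq_trace, hYP, Matrix.trace_zero]) hH
  have h2 := inner_lin_posTangentConeAt hV (by rw [inner_eq_trace, hYV, Matrix.trace_zero]) hH
  rw [show W = proj W - V by rw [hVdef]; abel, inner_sub_left, h1, h2, sub_zero]

end SymMat

/-! ### Regularity and invertibility of `N(x)` -/

theorem contDiff_semilinearIsometryEquiv {E F : Type*} [NormedAddCommGroup E] [NormedSpace ℝ E]
    [NormedAddCommGroup F] [NormedSpace ℝ F] (e : E ≃ₗᵢ⋆[ℝ] F) {k : WithTop ℕ∞} :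
    ContDiff ℝ k e :=
  IsBoundedLinearMap.contDiff
    { map_add := map_add e
      map_smul := fun c x => by simp
      bound := ⟨1, one_pos, fun x => by simp⟩ }

theorem _root_.ContDiff.adjoint {X E F : Type*} [NormedAddCommGroup X] [NormedSpace ℝ X]
    [NormedAddCommGroup E] [InnerProductSpace ℝ E] [CompleteSpace E]
    [NormedAddCommGroup F] [InnerProductSpace ℝ F] [CompleteSpace F] {k : WithTop ℕ∞}
    {A : X → E →L[ℝ] F} (hA : ContDiff ℝ k A) :
    ContDiff ℝ k fun x => ContinuousLinearMap.adjoint (A x) :=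
  (contDiff_semilinearIsometryEquiv
    (ContinuousLinearMap.adjoint : (E →L[ℝ] F) ≃ₗᵢ⋆[ℝ] (F →L[ℝ] E))).comp hA

theorem _root_.ContDiff.smul_fun {X E : Type*} [NormedAddCommGroup X] [NormedSpace ℝ X]
    [NormedAddCommGroup E] [NormedSpace ℝ E] {k : WithTop ℕ∞} {r : X → ℝ} (hr : ContDiff ℝ k r)
    (v : E) : ContDiff ℝ k fun x => r x • v := hr.smul contDiff_const

section Problem

variable {n m : ℕ} {f : EuclideanSpace ℝ (Fin n) → ℝ} {G : EuclideanSpace ℝ (Fin n) → SymMat m}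

theorem contDiff_gradient (hf : ContDiff ℝ 2 f) : ContDiff ℝ 1 (gradient f) :=
  (contDiff_semilinearIsometryEquiv
    (InnerProductSpace.toDual ℝ (EuclideanSpace ℝ (Fin n))).symm).comp
    (hf.fderiv_right (by norm_num))

theorem contDiff_residual (hG : ContDiff ℝ 1 G) : ContDiff ℝ 1 (residual G) :=
  contDiff_const.mul (contDiff_norm_sq_proj.comp hG.neg)

theorem contDiff_opN (hG : ContDiff ℝ 2 G) (ζ₁ ζ₂ : ℝ) : ContDiff ℝ 1 (opN G ζ₁ ζ₂) := by
  have hG1 : ContDiff ℝ 1 G := hG.of_le (by norm_num)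
  have hA : ContDiff ℝ 1 (fderiv ℝ G) := hG.fderiv_right (by norm_num)
  have hJ : ContDiff ℝ 1 fun x => jordanL (G x) :=
    ContDiff.comp (g := (jordanL : SymMat m → SymMat m →L[ℝ] SymMat m))
      isBoundedLinearMap_jordanL.contDiff hG1
  have hA' : ContDiff ℝ 1 fun x => ContinuousLinearMap.adjoint (fderiv ℝ G x) :=
    ContDiff.adjoint (E := EuclideanSpace ℝ (Fin n)) (F := SymMat m) hA
  have h1 : ContDiff ℝ 1 fun x =>
      (fderiv ℝ G x).comp (ContinuousLinearMap.adjoint (fderiv ℝ G x)) := hA.clm_comp hA'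
  have h2 : ContDiff ℝ 1 fun x => ζ₁ ^ 2 • (jordanL (G x)).comp (jordanL (G x)) :=
    (hJ.clm_comp hJ).const_smul _
  have h3 : ContDiff ℝ 1 fun x =>
      (ζ₂ ^ 2 * residual G x) • ContinuousLinearMap.id ℝ (SymMat m) :=
    ContDiff.smul_fun (E := SymMat m →L[ℝ] SymMat m)
      (contDiff_const.mul (contDiff_residual hG1)) _
  exact (h1.add h2).add h3

theorem opN_apply (ζ₁ ζ₂ : ℝ) (x : EuclideanSpace ℝ (Fin n)) (W : SymMat m) :
    opN G ζ₁ ζ₂ x W = fderiv ℝ G x (ContinuousLinearMap.adjoint (fderiv ℝ G x) W)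
      + ζ₁ ^ 2 • jordanL (G x) (jordanL (G x) W) + (ζ₂ ^ 2 * residual G x) • W := rfl

theorem inner_opN_left (ζ₁ ζ₂ : ℝ) (x : EuclideanSpace ℝ (Fin n)) (V W : SymMat m) :
    inner ℝ (opN G ζ₁ ζ₂ x V) W = inner ℝ V (opN G ζ₁ ζ₂ x W) := by
  simp only [opN_apply, inner_add_left, inner_add_right, real_inner_smul_left,
    real_inner_smul_right, inner_jordanL_left]
  rw [← ContinuousLinearMap.adjoint_inner_right, ContinuousLinearMap.adjoint_inner_left]

theorem residual_nonneg (x : EuclideanSpace ℝ (Fin n)) : 0 ≤ residual G x := by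
  unfold residual
  positivity

theorem residual_eq_zero {x : EuclideanSpace ℝ (Fin n)} (hx : Feasible G x) :
    residual G x = 0 := by
  rw [residual, proj_neg_eq_zero hx]
  simp

/-- At a feasible nondegenerate point the operator `N(x)` is injective. -/
theorem opN_injective {ζ₁ ζ₂ : ℝ} (hζ₁ : 0 < ζ₁) {x : EuclideanSpace ℝ (Fin n)}
    (hx : Feasible G x) (hnd : Nondegenerate G x) : Function.Injective (opN G ζ₁ ζ₂ x) := by
  rw [injective_iff_map_eq_zero]
  intro W hW
  -- The residual is zero at a feasible point, so the quadratic form of `N(x)` is a sum of two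
  -- squares.
  have h0 : inner ℝ (opN G ζ₁ ζ₂ x W) W = ‖ContinuousLinearMap.adjoint (fderiv ℝ G x) W‖ ^ 2
      + ζ₁ ^ 2 * ‖jordanL (G x) W‖ ^ 2 := by
    rw [opN_apply, residual_eq_zero hx, inner_add_left, inner_add_left, real_inner_smul_left,
      inner_jordanL_left, ← ContinuousLinearMap.adjoint_inner_right, real_inner_self_eq_norm_sq,
      real_inner_self_eq_norm_sq]
    simp
  rw [hW, inner_zero_left] at h0
  have h1 : 0 ≤ ζ₁ ^ 2 * ‖jordanL (G x) W‖ ^ 2 := by positivity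
  have h2 : ‖ContinuousLinearMap.adjoint (fderiv ℝ G x) W‖ ^ 2 = 0 :=
    le_antisymm (by linarith) (sq_nonneg _)
  have h3 : ζ₁ ^ 2 * ‖jordanL (G x) W‖ ^ 2 = 0 := by linarith
  have h4 : ContinuousLinearMap.adjoint (fderiv ℝ G x) W = 0 := by simpa using h2
  have h5 : jordanL (G x) W = 0 := by simpa [hζ₁.ne'] using h3
  obtain ⟨H, hH, v, hv⟩ := hnd W
  -- Writing `W = H + ∇G(x)v`, `W` is orthogonal to `H` since `G(x)W = 0`, and to `∇G(x)v` since
  -- `∇G(x)* W = 0`.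
  have h6 : inner ℝ W W = 0 := by
    nth_rewrite 2 [hv]
    rw [inner_add_right, inner_lin_posTangentConeAt_of_mul_eq_zero
      (mat_mul_eq_zero_of_jordan_eq_zero hx h5) hH, ← ContinuousLinearMap.adjoint_inner_left, h4]
    simp
  exact inner_self_eq_zero.1 h6

/-- An injective endomorphism of a finite-dimensional space is invertible, so `inverse` is a true
inverse rather than its default value `0`. -/
theorem opN_multiplierEstimate {ζ₁ ζ₂ : ℝ} {x : EuclideanSpace ℝ (Fin n)}
    (h : Function.Injective (opN G ζ₁ ζ₂ x)) :
    opN G ζ₁ ζ₂ x (multiplierEstimate f G ζ₁ ζ₂ x) = fderiv ℝ G x (gradient f x) :=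
  ContinuousLinearMap.IsInvertible.self_apply_inverse
    ⟨(LinearEquiv.ofInjectiveEndo (opN G ζ₁ ζ₂ x).toLinearMap h).toContinuousLinearEquiv,
      by ext; rfl⟩ _

/-- Near a feasible nondegenerate point `N(x)` is uniformly bounded below. -/
theorem exists_eventually_le_norm_opN (hG : ContDiff ℝ 2 G) {ζ₁ ζ₂ : ℝ} (hζ₁ : 0 < ζ₁)
    {x₀ : EuclideanSpace ℝ (Fin n)} (hx : Feasible G x₀) (hnd : Nondegenerate G x₀) :
    ∃ μ > 0, ∀ᶠ x in nhds x₀, ∀ W, μ * ‖W‖ ≤ ‖opN G ζ₁ ζ₂ x W‖ := by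
  obtain ⟨K, hK, hanti⟩ := LinearMap.exists_antilipschitzWith (opN G ζ₁ ζ₂ x₀).toLinearMap
    (LinearMap.ker_eq_bot.2 (opN_injective hζ₁ hx hnd))
  have hK' : (0 : ℝ) < K := hK
  -- Half of the lower bound at `x₀` is given up to the perturbation `N(x) - N(x₀)`.
  refine ⟨(K : ℝ)⁻¹ / 2, by positivity, ?_⟩
  have hc := (contDiff_opN hG ζ₁ ζ₂).continuous.tendsto x₀
  filter_upwards [Metric.tendsto_nhds.1 hc ((K : ℝ)⁻¹ / 2) (by positivity)] with x hx W
  have h1 : (K : ℝ)⁻¹ * ‖W‖ ≤ ‖opN G ζ₁ ζ₂ x₀ W‖ := by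
    have := hanti.le_mul_dist W 0
    simp only [dist_zero_right, map_zero] at this
    rw [inv_mul_le_iff₀ hK']
    exact this
  have h2 : ‖(opN G ζ₁ ζ₂ x - opN G ζ₁ ζ₂ x₀) W‖ ≤ (K : ℝ)⁻¹ / 2 * ‖W‖ :=
    ContinuousLinearMap.le_of_opNorm_le _ (by rw [← dist_eq_norm]; exact hx.le) W
  have h3 : ‖opN G ζ₁ ζ₂ x₀ W‖ ≤
      ‖opN G ζ₁ ζ₂ x W‖ + ‖(opN G ζ₁ ζ₂ x - opN G ζ₁ ζ₂ x₀) W‖ := by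
    rw [sub_apply]
    have := norm_sub_le (opN G ζ₁ ζ₂ x W) (opN G ζ₁ ζ₂ x W - opN G ζ₁ ζ₂ x₀ W)
    rwa [sub_sub_cancel] at this
  linarith

end Problem

end NSDP

namespace NSDP

open SymMat

/-! ### The defect and the two stationarity equations -/

theorem _root_.HasFDerivAt.eq_zero_of_gradient_eq_zero {E : Type*} [NormedAddCommGroup E]
    [InnerProductSpace ℝ E] [CompleteSpace E] {g : E → ℝ} {g' : E →L[ℝ] ℝ} {x : E}
    (h : HasFDerivAt g g' x) (h0 : gradient g x = 0) : g' = 0 := by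
  rw [← h.fderiv, ← toDual_gradient, h0, map_zero]

theorem _root_.Continuous.eventually_norm_le {E F : Type*} [TopologicalSpace E]
    [NormedAddCommGroup F] {g : E → F} (hg : Continuous g) (x₀ : E) :
    ∀ᶠ x in nhds x₀, ‖g x‖ ≤ ‖g x₀‖ + 1 :=
  (hg.norm.tendsto x₀).eventually_le_const (lt_add_one _)

theorem hasFDerivAt_sub_clm_apply {E F : Type*} [NormedAddCommGroup E] [NormedSpace ℝ E]
    [NormedAddCommGroup F] [NormedSpace ℝ F] {h : E → F} {N : E → F →L[ℝ] F}
    (hh : ContDiff ℝ 1 h) (hN : ContDiff ℝ 1 N) (Λ : F) (x : E) :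
    HasFDerivAt (fun y => h y - N y Λ) (fderiv ℝ h x - (fderiv ℝ N x).flip Λ) x := by
  have h1 := (hh.differentiable (by norm_num) x).hasFDerivAt
  have h2 := (hN.differentiable (by norm_num) x).hasFDerivAt
  refine (h1.sub (h2.clm_apply (hasFDerivAt_const Λ x))).congr_fderiv ?_
  ext v : 1
  simp

theorem exists_eventually_norm_fderiv_sub_apply_le {E F : Type*} [NormedAddCommGroup E]
    [NormedSpace ℝ E] [NormedAddCommGroup F] [NormedSpace ℝ F] {h : E → F} {N : E → F →L[ℝ] F}
    (hh : ContDiff ℝ 1 h) (hN : ContDiff ℝ 1 N) (x₀ : E) (R : ℝ) :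
    ∃ C, ∀ᶠ x in nhds x₀, ∀ Λ : F, ‖Λ‖ ≤ R → ‖fderiv ℝ (fun y => h y - N y Λ) x‖ ≤ C := by
  refine ⟨‖fderiv ℝ h x₀‖ + 1 + (‖fderiv ℝ N x₀‖ + 1) * R, ?_⟩
  filter_upwards [(hh.continuous_fderiv (by norm_num)).eventually_norm_le x₀,
    (hN.continuous_fderiv (by norm_num)).eventually_norm_le x₀] with x h1 h2 Λ hΛ
  rw [(hasFDerivAt_sub_clm_apply hh hN Λ x).fderiv]
  refine (norm_sub_le _ _).trans (add_le_add h1 ?_)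
  refine ((fderiv ℝ N x).flip.le_opNorm Λ).trans ?_
  rw [ContinuousLinearMap.opNorm_flip]
  gcongr

section Problem

variable {n m : ℕ} {f : EuclideanSpace ℝ (Fin n) → ℝ} {G : EuclideanSpace ℝ (Fin n) → SymMat m}

/-- The map `x ↦ ∇G(x) ∇f(x) - N(x) Λ`, which equals `N(x) (Λ(x) - Λ)` where `N(x)` is
invertible. -/
noncomputable def estimateDefect (f : EuclideanSpace ℝ (Fin n) → ℝ)
    (G : EuclideanSpace ℝ (Fin n) → SymMat m) (ζ₁ ζ₂ : ℝ) (Λ : SymMat m)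
    (x : EuclideanSpace ℝ (Fin n)) : SymMat m :=
  fderiv ℝ G x (gradient f x) - opN G ζ₁ ζ₂ x Λ

theorem opN_multiplierEstimate_sub {ζ₁ ζ₂ : ℝ} {x : EuclideanSpace ℝ (Fin n)}
    (h : Function.Injective (opN G ζ₁ ζ₂ x)) (Λ : SymMat m) :
    opN G ζ₁ ζ₂ x (multiplierEstimate f G ζ₁ ζ₂ x - Λ) = estimateDefect f G ζ₁ ζ₂ Λ x := by
  rw [map_sub, opN_multiplierEstimate h, estimateDefect]

theorem contDiff_fderiv_apply_gradient (hf : ContDiff ℝ 2 f) (hG : ContDiff ℝ 2 G) :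
    ContDiff ℝ 1 fun x => fderiv ℝ G x (gradient f x) :=
  ContDiff.clm_apply (hG.fderiv_right (by norm_num)) (contDiff_gradient hf)

theorem differentiableAt_estimateDefect (hf : ContDiff ℝ 2 f) (hG : ContDiff ℝ 2 G) (ζ₁ ζ₂ : ℝ)
    (Λ : SymMat m) (x : EuclideanSpace ℝ (Fin n)) :
    DifferentiableAt ℝ (estimateDefect f G ζ₁ ζ₂ Λ) x :=
  (hasFDerivAt_sub_clm_apply (F := SymMat m) (contDiff_fderiv_apply_gradient hf hG)
    (contDiff_opN hG ζ₁ ζ₂) Λ x).differentiableAt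

theorem exists_eventually_norm_fderiv_estimateDefect_le (hf : ContDiff ℝ 2 f)
    (hG : ContDiff ℝ 2 G) (ζ₁ ζ₂ R : ℝ) (x₀ : EuclideanSpace ℝ (Fin n)) :
    ∃ C, ∀ᶠ x in nhds x₀, ∀ Λ : SymMat m, ‖Λ‖ ≤ R →
      ‖fderiv ℝ (estimateDefect f G ζ₁ ζ₂ Λ) x‖ ≤ C :=
  exists_eventually_norm_fderiv_sub_apply_le (F := SymMat m)
    (contDiff_fderiv_apply_gradient hf hG) (contDiff_opN hG ζ₁ ζ₂) x₀ R

/-- Stationarity in the multiplier. -/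
theorem IsStationary.proj_eq {ζ₁ ζ₂ c : ℝ} (hc : c ≠ 0) {x : EuclideanSpace ℝ (Fin n)}
    {Λ : SymMat m} (hN : Function.Injective (opN G ζ₁ ζ₂ x))
    (hs : IsStationary f G ζ₁ ζ₂ c x Λ) :
    proj (Λ - c • G x) =
      Λ + (2 * c) • opN G ζ₁ ζ₂ x (estimateDefect f G ζ₁ ζ₂ Λ x) := by
  have h1 := (hasFDerivAt_norm_sq_proj (Λ - c • G x)).comp Λ
    ((hasFDerivAt_id Λ).sub_const (c • G x))
  have h2 := (hasFDerivAt_id Λ).norm_sq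
  have h3 := ((opN G ζ₁ ζ₂ x).hasFDerivAt.comp Λ
    ((hasFDerivAt_id Λ).const_sub (multiplierEstimate f G ζ₁ ζ₂ x))).norm_sq
  have h4 := (((h1.sub h2).const_mul (1 / (2 * c))).const_add (f x)).add h3
  have h5 := HasFDerivAt.eq_zero_of_gradient_eq_zero h4 hs.2
  rw [← sub_eq_zero]
  refine ext_inner_right ℝ fun V => ?_
  have h6 := congrArg (fun L => L V) h5
  simp [opN_multiplierEstimate_sub hN] at h6
  rw [← sub_sub, inner_sub_left, inner_sub_left, inner_zero_left, real_inner_smul_left,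
    inner_opN_left]
  field_simp at h6
  linarith

/-- Stationarity in the primal variable. -/
theorem IsStationary.gradient_eq (hf : ContDiff ℝ 2 f) (hG : ContDiff ℝ 2 G)
    {ζ₁ ζ₂ c : ℝ} (hc : c ≠ 0) {x : EuclideanSpace ℝ (Fin n)}
    {Λ : SymMat m} (hN : ∀ᶠ y in nhds x, Function.Injective (opN G ζ₁ ζ₂ y))
    (hs : IsStationary f G ζ₁ ζ₂ c x Λ) :
    gradient f x = ContinuousLinearMap.adjoint (fderiv ℝ G x) (proj (Λ - c • G x))
      - (2 : ℝ) • ContinuousLinearMap.adjoint (fderiv ℝ (estimateDefect f G ζ₁ ζ₂ Λ) x)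
        (estimateDefect f G ζ₁ ζ₂ Λ x) := by
  have hf1 := (hf.differentiable (by norm_num) x).hasFDerivAt
  have hG1 := (hG.differentiable (by norm_num) x).hasFDerivAt
  have h1 := (hasFDerivAt_norm_sq_proj (Λ - c • G x)).comp x ((hG1.const_smul c).const_sub Λ)
  have h3 := (differentiableAt_estimateDefect hf hG ζ₁ ζ₂ Λ x).hasFDerivAt.norm_sq
  have h4 := (hf1.add ((h1.sub_const (‖Λ‖ ^ 2)).const_mul (1 / (2 * c)))).add h3
  -- Injectivity on a neighbourhood allows the penalty to be replaced by `‖w‖²` before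
  -- differentiating, so `N⁻¹` is never differentiated.
  have h5 := h4.congr_of_eventuallyEq (f₁ := fun y => augLagrangian f G ζ₁ ζ₂ c y Λ) (by
    filter_upwards [hN] with y hy
    simp only [augLagrangian, opN_multiplierEstimate_sub hy]
    rfl)
  have h6 := HasFDerivAt.eq_zero_of_gradient_eq_zero h5 hs.1
  rw [← sub_eq_zero]
  refine ext_inner_right ℝ fun v => ?_
  have h7 := congrArg (fun L => L v) h6
  have h8 : fderiv ℝ f x v = inner ℝ (gradient f x) v := by
    rw [← toDual_gradient, InnerProductSpace.toDual_apply_apply]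
  simp at h7
  rw [h8] at h7
  rw [inner_sub_left, inner_sub_left, inner_zero_left, real_inner_smul_left,
    ContinuousLinearMap.adjoint_inner_left, ContinuousLinearMap.adjoint_inner_left]
  field_simp at h7
  linarith

theorem hasGradientAt_lagrangian (hf : ContDiff ℝ 2 f) (hG : ContDiff ℝ 2 G)
    (x : EuclideanSpace ℝ (Fin n)) (Λ : SymMat m) :
    HasGradientAt (fun y => lagrangian f G y Λ)
      (gradient f x - ContinuousLinearMap.adjoint (fderiv ℝ G x) Λ) x := by
  have hf1 := (hf.differentiable (by norm_num) x).hasFDerivAt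
  have hG1 := (hG.differentiable (by norm_num) x).hasFDerivAt
  rw [hasGradientAt_iff_hasFDerivAt]
  refine (hf1.sub (hG1.inner ℝ (hasFDerivAt_const Λ x))).congr_fderiv ?_
  ext v
  rw [map_sub, toDual_gradient]
  simp [ContinuousLinearMap.adjoint_inner_left, real_inner_comm Λ]

/-! ### Vanishing of the defect -/

/-- The estimate behind the exactness result: the defect vanishes for large `c`. -/
theorem eq_zero_of_norm_identity {μ C J R K ε c a w y : ℝ} {ζ₁ ζ₂ : ℝ} (hμ : 0 < μ)
    (hJ : 0 ≤ J) (hc0 : 0 < c) (hw : 0 ≤ w) (hy : y ≤ R + c * ε)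
    (hε : (2 * ζ₁ ^ 2 * C ^ 2 * J + ζ₂ ^ 2 * C ^ 2) * ε ≤ μ ^ 2)
    (hc : (1 + (2 * ζ₁ ^ 2 * C ^ 2 * J + ζ₂ ^ 2 * C ^ 2) * R + 2 * C * K) / μ ^ 2 < c)
    (ha : μ ^ 2 * w ≤ a)
    (h : 2 * c * a ≤ w + 2 * ζ₁ ^ 2 * (C * (J * y * (C * w))) + ζ₂ ^ 2 * (C * (C * w) * y)
      + 2 * (C * (K * w))) : w = 0 := by
  set D := 2 * ζ₁ ^ 2 * C ^ 2 * J + ζ₂ ^ 2 * C ^ 2 with hD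
  have hD0 : 0 ≤ D := by positivity
  rw [div_lt_iff₀ (by positivity)] at hc
  have h1 : 2 * c * (μ ^ 2 * w) ≤ (1 + D * y + 2 * C * K) * w :=
    (mul_le_mul_of_nonneg_left ha (by positivity)).trans (h.trans (by rw [hD]; nlinarith))
  -- The part of `D * y` growing with `c` uses only half of `2cμ²`; the other half beats the
  -- constants by the choice of `c`.
  have h2 : D * y ≤ D * R + c * μ ^ 2 := by
    nlinarith [mul_le_mul_of_nonneg_left hy hD0, mul_le_mul_of_nonneg_left hε hc0.le]
  by_contra hne
  have hw' : 0 < w := lt_of_le_of_ne hw (Ne.symm hne)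
  have h3 : 2 * c * μ ^ 2 ≤ 1 + D * y + 2 * C * K := by
    refine le_of_mul_le_mul_right ?_ hw'
    linarith
  linarith

/-- Norms are taken in the identity for `2cN²w`. Every term on its right carries a factor `w`: for
`𝓛_G Y` and `r` this comes from Moreau's decomposition. -/
theorem IsStationary.norm_estimate (hf : ContDiff ℝ 2 f) (hG : ContDiff ℝ 2 G)
    {ζ₁ ζ₂ c C J K : ℝ} (hc : 0 < c) (hC : 0 ≤ C) (hJ : 0 ≤ J)
    {x : EuclideanSpace ℝ (Fin n)} {Λ : SymMat m}
    (hN : ∀ᶠ y in nhds x, Function.Injective (opN G ζ₁ ζ₂ y))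
    (hs : IsStationary f G ζ₁ ζ₂ c x Λ)
    (hJb : ∀ Y Z : SymMat m, ‖jordanL Y Z‖ ≤ J * ‖Y‖ * ‖Z‖)
    (hNb : ∀ W, ‖opN G ζ₁ ζ₂ x W‖ ≤ C * ‖W‖) (hLb : ∀ W, ‖jordanL (G x) W‖ ≤ C * ‖W‖)
    (hAb : ‖fderiv ℝ G x‖ ≤ C) (hGb : ‖G x‖ ≤ C)
    (hKb : ‖fderiv ℝ (estimateDefect f G ζ₁ ζ₂ Λ) x‖ ≤ K) :
    2 * c * ‖opN G ζ₁ ζ₂ x (opN G ζ₁ ζ₂ x (estimateDefect f G ζ₁ ζ₂ Λ x))‖ ≤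
      ‖estimateDefect f G ζ₁ ζ₂ Λ x‖
      + 2 * ζ₁ ^ 2 * (C * (J * ‖proj (Λ - c • G x)‖ * (C * ‖estimateDefect f G ζ₁ ζ₂ Λ x‖)))
      + ζ₂ ^ 2 * (C * (C * ‖estimateDefect f G ζ₁ ζ₂ Λ x‖) * ‖proj (Λ - c • G x)‖)
      + 2 * (C * (K * ‖estimateDefect f G ζ₁ ζ₂ Λ x‖)) := by
  have hproj := hs.proj_eq hc.ne' hN.self_of_nhds
  have hgrad := hs.gradient_eq hf hG hc.ne' hN
  have hmoreau := jordan_proj_proj_sub_self (Λ - c • G x)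
  have hpsd := proj_sub_self_mem_psdCone (Λ - c • G x)
  have hw : estimateDefect f G ζ₁ ζ₂ Λ x = fderiv ℝ G x (gradient f x) - opN G ζ₁ ζ₂ x Λ := rfl
  set w := estimateDefect f G ζ₁ ζ₂ Λ x
  set Y := proj (Λ - c • G x)
  set B := ContinuousLinearMap.adjoint (fderiv ℝ (estimateDefect f G ζ₁ ζ₂ Λ) x) with hB
  have hsub : Y - (Λ - c • G x) = c • ((2 : ℝ) • opN G ζ₁ ζ₂ x w + G x) := by
    rw [hproj]
    module
  rw [hsub, ← jordanL_apply, map_smul, smul_eq_zero_iff_right hc.ne', map_add, map_smul] at hmoreau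
  have hLY : jordanL (G x) Y = -((2 : ℝ) • jordanL Y (opN G ζ₁ ζ₂ x w)) := by
    rw [jordanL_apply, jordan_comm, ← jordanL_apply]
    exact eq_neg_of_add_eq_zero_right hmoreau
  -- In `r = ‖P(-G)‖²/2`, one factor is compared with the cone point `G + 2Nw`, giving `2C‖w‖`, the
  -- other with `0`, giving `C`.
  have hres : residual G x * ‖Y‖ ≤ C * (C * ‖w‖) * ‖Y‖ := by
    refine mul_le_mul_of_nonneg_right ?_ (norm_nonneg _)
    rw [hsub] at hpsd
    have hpsd' := smul_mem_psdCone hpsd (inv_nonneg.2 hc.le)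
    rw [inv_smul_smul₀ hc.ne'] at hpsd'
    have h1 := norm_proj_neg_le (G x) hpsd'
    rw [add_sub_cancel_right, norm_smul, Real.norm_two] at h1
    have h2 := norm_proj_neg_le (G x) zero_mem_psdCone
    rw [zero_sub, norm_neg] at h2
    have h3 := hNb w
    rw [residual, sq]
    have h4 := mul_le_mul (h2.trans hGb) (h1.trans (by linarith : _ ≤ 2 * (C * ‖w‖)))
      (norm_nonneg _) hC
    linarith
  have hkey : (2 * c) • opN G ζ₁ ζ₂ x (opN G ζ₁ ζ₂ x w) =
      w - (2 * ζ₁ ^ 2) • jordanL (G x) (jordanL Y (opN G ζ₁ ζ₂ x w))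
        + (ζ₂ ^ 2 * residual G x) • Y + (2 : ℝ) • fderiv ℝ G x (B w) := by
    have h1 : opN G ζ₁ ζ₂ x Y =
        opN G ζ₁ ζ₂ x Λ + (2 * c) • opN G ζ₁ ζ₂ x (opN G ζ₁ ζ₂ x w) := by
      nth_rewrite 1 [hproj]
      rw [map_add, map_smul]
    have h2 : fderiv ℝ G x (gradient f x) =
        fderiv ℝ G x (ContinuousLinearMap.adjoint (fderiv ℝ G x) Y)
          - (2 : ℝ) • fderiv ℝ G x (B w) := by
      rw [hgrad, map_sub, map_smul]
    rw [opN_apply ζ₁ ζ₂ x Y, hLY, map_neg, map_smul] at h1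
    rw [h2] at hw
    rw [eq_sub_iff_add_eq] at hw
    -- The terms `∇G ∇G* Y` and `NΛ` cancel between the two equations.
    linear_combination (norm := module) (-1 : ℝ) • h1 + (-1 : ℝ) • hw
  have hn : 2 * c * ‖opN G ζ₁ ζ₂ x (opN G ζ₁ ζ₂ x w)‖ =
      ‖(2 * c) • opN G ζ₁ ζ₂ x (opN G ζ₁ ζ₂ x w)‖ := by
    rw [norm_smul, Real.norm_of_nonneg (by positivity)]
  rw [hn, hkey]
  refine (norm_add_le _ _).trans (add_le_add ((norm_add_le _ _).trans
    (add_le_add ((norm_sub_le _ _).trans (add_le_add le_rfl ?_)) ?_)) ?_)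
  · rw [norm_smul, Real.norm_of_nonneg (by positivity)]
    refine mul_le_mul_of_nonneg_left ?_ (by positivity)
    refine (hLb _).trans (mul_le_mul_of_nonneg_left ?_ hC)
    exact (hJb _ _).trans (mul_le_mul_of_nonneg_left (hNb w) (by positivity))
  · rw [norm_smul, Real.norm_of_nonneg (mul_nonneg (sq_nonneg _) (residual_nonneg x)), mul_assoc]
    exact mul_le_mul_of_nonneg_left hres (sq_nonneg _)
  · rw [norm_smul, Real.norm_two]
    refine mul_le_mul_of_nonneg_left ?_ zero_le_two
    refine (ContinuousLinearMap.le_of_opNorm_le _ hAb _).trans (mul_le_mul_of_nonneg_left ?_ hC)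
    refine ContinuousLinearMap.le_of_opNorm_le _ ?_ _
    rw [hB, LinearIsometryEquiv.norm_map]
    exact hKb

/-- A stationary point at which the defect vanishes is a KKT pair. -/
theorem IsStationary.isKKTPair (hf : ContDiff ℝ 2 f) (hG : ContDiff ℝ 2 G)
    {ζ₁ ζ₂ c : ℝ} (hc : 0 < c) {x : EuclideanSpace ℝ (Fin n)} {Λ : SymMat m}
    (hN : ∀ᶠ y in nhds x, Function.Injective (opN G ζ₁ ζ₂ y))
    (hs : IsStationary f G ζ₁ ζ₂ c x Λ) (hw : estimateDefect f G ζ₁ ζ₂ Λ x = 0) :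
    IsKKTPair f G x Λ := by
  have hproj := hs.proj_eq hc.ne' hN.self_of_nhds
  have hgrad := hs.gradient_eq hf hG hc.ne' hN
  have hmoreau := jordan_proj_proj_sub_self (Λ - c • G x)
  have hpsd := proj_sub_self_mem_psdCone (Λ - c • G x)
  have hmem := proj_mem (Λ - c • G x)
  rw [hw, map_zero, smul_zero, add_zero] at hproj
  rw [hproj, sub_sub_cancel] at hmoreau hpsd
  rw [hproj, hw, map_zero, smul_zero, sub_zero] at hgrad
  rw [hproj] at hmem
  refine ⟨?_, ?_, ?_, hmem⟩
  · rw [(hasGradientAt_lagrangian hf hG x Λ).gradient, ← hgrad, sub_self]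
  · rwa [← jordanL_apply, map_smul, smul_eq_zero_iff_right hc.ne'] at hmoreau
  · have := smul_mem_psdCone hpsd (inv_nonneg.2 hc.le)
    rwa [inv_smul_smul₀ hc.ne'] at this

end Problem

end NSDP

/-! ### Choice of the constants -/

theorem mainTheorem4 (n m : ℕ) (f : EuclideanSpace ℝ (Fin n) → ℝ)
    (G : EuclideanSpace ℝ (Fin n) → NSDP.SymMat m)
    (hf : ContDiff ℝ 2 f) (hG : ContDiff ℝ 2 G)
    (ζ₁ ζ₂ : ℝ) (hζ₁ : 0 < ζ₁) (hζ₂ : 0 < ζ₂)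
    (hnd : ∀ x, NSDP.Feasible G x → NSDP.Nondegenerate G x)
    (x₀ : EuclideanSpace ℝ (Fin n)) (hx₀ : NSDP.Feasible G x₀) (Λ₀ : NSDP.SymMat m) :
    ∃ c₀ δ₁ δ₂ : ℝ, 0 < c₀ ∧ 0 < δ₁ ∧ 0 < δ₂ ∧
      ∀ (x : EuclideanSpace ℝ (Fin n)) (Λ : NSDP.SymMat m) (c : ℝ),
        NSDP.IsStationary f G ζ₁ ζ₂ c x Λ → ‖x - x₀‖ ≤ δ₁ → ‖Λ - Λ₀‖ ≤ δ₂ → c₀ ≤ c →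
          NSDP.IsKKTPair f G x Λ := by
  obtain ⟨μ, hμ, hlow⟩ := NSDP.exists_eventually_le_norm_opN (ζ₂ := ζ₂) hG hζ₁ hx₀ (hnd x₀ hx₀)
  obtain ⟨J, hJ, hJb⟩ := (NSDP.SymMat.isBoundedLinearMap_jordanL (m := m)).bound
  obtain ⟨K, hK⟩ := NSDP.exists_eventually_norm_fderiv_estimateDefect_le hf hG ζ₁ ζ₂
    (‖Λ₀‖ + 1) x₀
  have hN := (NSDP.contDiff_opN hG ζ₁ ζ₂).continuous.eventually_norm_le x₀
  have hL := (ContDiff.comp (n := 2)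
    (g := (NSDP.SymMat.jordanL : NSDP.SymMat m → NSDP.SymMat m →L[ℝ] NSDP.SymMat m))
    NSDP.SymMat.isBoundedLinearMap_jordanL.contDiff hG).continuous.eventually_norm_le x₀
  have hA := (hG.continuous_fderiv (by norm_num)).eventually_norm_le x₀
  have hGb := hG.continuous.eventually_norm_le x₀
  obtain ⟨C, hC, hCN, hCL, hCA, hCG⟩ : ∃ C : ℝ, 0 ≤ C ∧ ‖NSDP.opN G ζ₁ ζ₂ x₀‖ + 1 ≤ C ∧
      ‖NSDP.SymMat.jordanL (G x₀)‖ + 1 ≤ C ∧ ‖fderiv ℝ G x₀‖ + 1 ≤ C ∧ ‖G x₀‖ + 1 ≤ C := by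
    have h1 := norm_nonneg (NSDP.opN G ζ₁ ζ₂ x₀)
    have h2 := norm_nonneg (NSDP.SymMat.jordanL (G x₀))
    have h3 := norm_nonneg (fderiv ℝ G x₀)
    have h4 := norm_nonneg (G x₀)
    exact ⟨‖NSDP.opN G ζ₁ ζ₂ x₀‖ + ‖NSDP.SymMat.jordanL (G x₀)‖ + ‖fderiv ℝ G x₀‖ + ‖G x₀‖ + 1,
      by linarith, by linarith, by linarith, by linarith, by linarith⟩
  set D := 2 * ζ₁ ^ 2 * C ^ 2 * J + ζ₂ ^ 2 * C ^ 2 with hD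
  have hD0 : 0 ≤ D := by positivity
  -- `D + 1` replaces `D`, which may be zero.
  have hε : 0 < μ ^ 2 / (D + 1) := by positivity
  have hDε : D * (μ ^ 2 / (D + 1)) ≤ μ ^ 2 := by
    rw [mul_div_assoc', div_le_iff₀ (by positivity)]
    nlinarith [sq_nonneg μ]
  have hnear : ∀ᶠ x in nhds x₀, ‖G x - G x₀‖ < μ ^ 2 / (D + 1) := by
    simpa [dist_eq_norm] using Metric.tendsto_nhds.1 (hG.continuous.tendsto x₀) _ hε
  -- `eventually_nhds` keeps the lower bound on a neighbourhood of each nearby `x`, as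
  -- differentiation in `x` requires.
  obtain ⟨δ, hδ, hball⟩ := Metric.eventually_nhds_iff.1
    ((((((hlow.eventually_nhds.and hK).and hN).and hL).and hA).and hGb).and hnear)
  -- The `max` ensures `c > 0` and the last `+ 1` a strict inequality; `δ / 2` fits a closed ball
  -- into the open one, and radius `1` matches `R = ‖Λ₀‖ + 1`.
  refine ⟨max 1 ((1 + D * (‖Λ₀‖ + 1) + 2 * C * K) / μ ^ 2 + 1), δ / 2, 1,
    lt_max_of_lt_left one_pos, by positivity, one_pos, ?_⟩
  intro x Λ c hs hx hΛ hc
  obtain ⟨⟨⟨⟨⟨⟨hlowx, hKx⟩, hNx⟩, hLx⟩, hAx⟩, hGx⟩, hnearx⟩ :=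
    hball (y := x) (by rw [dist_eq_norm]; linarith)
  have hc0 : 0 < c := one_pos.trans_le ((le_max_left _ _).trans hc)
  have hc1 := (lt_add_one _).trans_le ((le_max_right _ _).trans hc)
  have hΛ' : ‖Λ‖ ≤ ‖Λ₀‖ + 1 := by
    have := norm_add_le (Λ - Λ₀) Λ₀
    rw [sub_add_cancel] at this
    linarith
  have hinj : ∀ᶠ y in nhds x, Function.Injective (NSDP.opN G ζ₁ ζ₂ y) := by
    filter_upwards [hlowx] with y hy
    rw [injective_iff_map_eq_zero]
    intro W hW
    have h1 := hy W
    rw [hW, norm_zero] at h1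
    exact norm_le_zero_iff.1 (nonpos_of_mul_nonpos_right h1 hμ)
  have hlow0 := hlowx.self_of_nhds
  refine hs.isKKTPair hf hG hc0 hinj (norm_eq_zero.1 ?_)
  have hy : ‖NSDP.SymMat.proj (Λ - c • G x)‖ ≤ (‖Λ₀‖ + 1) + c * (μ ^ 2 / (D + 1)) := by
    -- Feasibility of `x₀` gives `P(-cG(x₀)) = 0`, so only `‖Λ - c(G(x) - G(x₀))‖` remains.
    have h1 := NSDP.SymMat.norm_proj_sub_proj_le (Λ - c • G x) (-(c • G x₀))
    rw [NSDP.SymMat.proj_neg_eq_zero (NSDP.SymMat.smul_mem_psdCone hx₀ hc0.le), sub_zero,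
      show Λ - c • G x - -(c • G x₀) = Λ - c • (G x - G x₀) by module] at h1
    have h2 := norm_sub_le Λ (c • (G x - G x₀))
    rw [norm_smul, Real.norm_of_nonneg hc0.le] at h2
    have h3 := mul_le_mul_of_nonneg_left hnearx.le hc0.le
    linarith
  have hJb' : ∀ Y Z : NSDP.SymMat m, ‖NSDP.SymMat.jordanL Y Z‖ ≤ J * ‖Y‖ * ‖Z‖ := fun Y Z =>
    ContinuousLinearMap.le_of_opNorm_le _ (hJb Y) Z
  have hest := hs.norm_estimate hf hG hc0 hC hJ.le hinj hJb'
    (ContinuousLinearMap.le_of_opNorm_le _ (hNx.trans hCN))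
    (ContinuousLinearMap.le_of_opNorm_le _ (hLx.trans hCL)) (hAx.trans hCA) (hGx.trans hCG)
    (hKx Λ hΛ')
  refine NSDP.eq_zero_of_norm_identity hμ hJ.le hc0 (norm_nonneg _) hy hDε hc1 ?_ hest
  rw [sq, mul_assoc]
  exact (mul_le_mul_of_nonneg_left (hlow0 _) hμ.le).trans (hlow0 _)
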